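/- Let $r\ge 0$ and let $d_1,\dots,d_r\ge 5$ be integers. For permutation groups $\Gamma_i\le \mathrm{Sym}(\{1,\dots,d_i\})$, $i=1,\dots,r$, let $\Gamma_r\wr\cdots\wr\Gamma_1$ denote the iterated imprimitive wreath product, defined recursively by $\Gamma_r\wr\cdots\wr\Gamma_1=(\Gamma_r\wr\cdots\wr\Gamma_2)^{d_1}\rtimes\Gamma_1$, where $\Gamma_1$ permutes the $d_1$ coordinates (the empty wreath product is the trivial group). Let $G$ be a subgroup of $S_{d_r}\wr\cdots\wr S_{d_1}$ such that the multiset of (Jordan–Hölder) composition factors of $G$, taken up to isomorphism, contains, with multiplicities, the multiset of composition factors of $A_{d_r}\wr\cdots\wr A_{d_1}$. Then $G$ contains a subgroup isomorphic to $A_{d_r}\wr\cdots\wr A_{d_1}$. -/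

import Mathlib

/-- The wreath product `U ≀_J V`: the semidirect product `U ^ J ⋊ V`, where `V` acts on `U ^ J` by
permuting the coordinates, `(v • u) j = u (v⁻¹ • j)`. -/
abbrev PermWreath (U J V : Type*) [Group U] [Group V] [MulAction V J] : Type _ :=
  (J → U) ⋊[(mulAutArrow : V →* MulAut (J → U))] V

/-- The iterated wreath product `[Γ i] = Γ (r - 1) ≀ ⋯ ≀ Γ 1 ≀ Γ 0` of permutation groups
`Γ i ≤ Sym (d i)`, as a group. The group `Γ 0` is the outermost (top) one, permuting `d 0` copies
of the iterated wreath product of the remaining ones; for `r = 0` it is the trivial group. -/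
def iterWreath : (r : ℕ) → (d : Fin r → ℕ) →
    ((i : Fin r) → Subgroup (Equiv.Perm (Fin (d i)))) → GrpCat.{0}
  | 0, _, _ => GrpCat.of PUnit
  | r + 1, d, Γ =>
    GrpCat.of (PermWreath (iterWreath r (fun i => d i.succ) (fun i => Γ i.succ)) (Fin (d 0)) (Γ 0))

/-- The iterated wreath product `S_{d_r} ≀ ⋯ ≀ S_{d_1}` (with `d i` for `d_{i+1}`). -/
abbrev iterWreathSymm {r : ℕ} (d : Fin r → ℕ) : GrpCat.{0} :=
  iterWreath r d (fun _ => ⊤)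

/-- The iterated wreath product `A_{d_r} ≀ ⋯ ≀ A_{d_1}` (with `d i` for `d_{i+1}`). -/
abbrev iterWreathAlt {r : ℕ} (d : Fin r → ℕ) : GrpCat.{0} :=
  iterWreath r d (fun i => alternatingGroup (Fin (d i)))

/-- A composition series `1 = H_0 ⊲ H_1 ⊲ ⋯ ⊲ H_n = G` of a group, with simple quotients. -/
structure GroupCompSeries (G : Type*) [Group G] where
  /-- The number of factors. -/
  length : ℕ
  /-- The terms of the series. -/
  term : Fin (length + 1) → Subgroup G
  term_zero : term 0 = ⊥
  term_last : term (Fin.last length) = ⊤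
  le_succ : ∀ i : Fin length, term i.castSucc ≤ term i.succ
  normal : ∀ i : Fin length, ((term i.castSucc).subgroupOf (term i.succ)).Normal
  simple : ∀ i : Fin length,
    haveI := normal i
    IsSimpleGroup (term i.succ ⧸ (term i.castSucc).subgroupOf (term i.succ))

/-- The `i`-th composition factor `H_{i+1} / H_i` of a composition series. -/
abbrev GroupCompSeries.factor {G : Type*} [Group G] (s : GroupCompSeries G) (i : Fin s.length) :
    Type _ :=
  s.term i.succ ⧸ (s.term i.castSucc).subgroupOf (s.term i.succ)

instance GroupCompSeries.factorGroup {G : Type*} [Group G] (s : GroupCompSeries G)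
    (i : Fin s.length) : Group (s.factor i) :=
  haveI := s.normal i
  QuotientGroup.Quotient.group _

/-- `G` contains the composition factors of `B`: the multiset of composition factors of `B`, up to
isomorphism, is contained (with multiplicities) in that of `G`. By the Jordan-Hölder theorem the
choice of the two composition series is immaterial. -/
def ContainsCompFactors (G B : Type*) [Group G] [Group B] : Prop :=
  ∃ (s : GroupCompSeries G) (t : GroupCompSeries B) (σ : Fin t.length ↪ Fin s.length),
    ∀ i : Fin t.length, Nonempty (t.factor i ≃* s.factor (σ i))

/-! Write `U` for the iterated wreath product of symmetric groups and `A` for that of alternating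
groups. The invariant is the product of the orders of the nonabelian composition factors. It splits
as kernel times image under homomorphisms (`SimpleChain.exists_ker_map`), so on subgroups of `U` it
is at most |A|. Since `A` has no abelian composition factor, the hypothesis makes the invariant of
`G` at least |A|, so equality holds at every level: `G` maps onto a group containing the alternating
group of the top level, and its intersection with each coordinate of the base group is again
extremal. Such subgroups are called full. Jordan–Hölder is never needed, since the bounds hold for
every chain.

It remains to embed `A` in a full subgroup, by induction on the number of levels
(`FullnessData.wreath`). Fullness leaves only powers of 2 between the orders of a full subgroup and
of the whole group, so elements of 3-power order that normalize a full subgroup lie in it. Hence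
each 3-cycle has a lift in `G` that is a conjugate of the standard 3-cycle by a base element
(`hasThreeCycleLifts_of_card_dvd`). The conjugating elements are then made equal, first on five
points and then one point at a time (`HasThreeCycleLifts.exists_alternatingGroup_le`). The resulting
conjugate of the alternating group, together with the copies found in the coordinates, generates the
required wreath product. -/

/-! ### Subnormal chains and their weights under homomorphisms. -/

/-- `H` is normal in `K` and `K / H` is simple or trivial. -/
structure SimpleStep {G : Type*} [Group G] (H K : Subgroup G) : Prop where
  le : H ≤ K
  conj : ∀ k ∈ K, ∀ h ∈ H, k * h * k⁻¹ ∈ H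
  simple : ∀ N : Subgroup G, H ≤ N → N ≤ K → (∀ k ∈ K, ∀ n ∈ N, k * n * k⁻¹ ∈ N) → N = H ∨ N = K

open Classical in
/-- For the order `n` of a simple group, this is `n` if the group is abelian and `p` holds, or if the
group is not abelian and `p` fails; otherwise it is `1`. -/
noncomputable def stepWeight (p : Prop) (n : ℕ) : ℕ := if (n.Prime ↔ p) then n else 1

/-- There is a subnormal series from `⊥` to `K`, with factors simple or trivial, such that the
product of the weights of its factors is `m`. -/
inductive SimpleChain (p : Prop) {G : Type*} [Group G] : Subgroup G → ℕ → Prop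
  | bot : SimpleChain p ⊥ 1
  | step {H K : Subgroup G} {m : ℕ} : SimpleChain p H m → SimpleStep H K →
      SimpleChain p K (m * stepWeight p (H.relIndex K))

lemma stepWeight_one (p : Prop) : stepWeight p 1 = 1 := by
  simp [stepWeight]

lemma stepWeight_true_mul_false (n : ℕ) : stepWeight True n * stepWeight False n = n := by
  by_cases h : n.Prime <;> simp [stepWeight, h]

lemma stepWeight_le (p : Prop) {n : ℕ} (hn : n ≠ 0) : stepWeight p n ≤ n := by
  unfold stepWeight
  split_ifs <;> omega

lemma stepWeight_pos (p : Prop) {n : ℕ} (hn : n ≠ 0) : 0 < stepWeight p n := by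
  unfold stepWeight
  split_ifs <;> omega

section

variable {G H : Type*} [Group G] [Group H] {p : Prop}

lemma Subgroup.relIndex_ne_zero_of_finite [Finite G] (A B : Subgroup G) : A.relIndex B ≠ 0 :=
  Subgroup.index_ne_zero_of_finite

lemma Subgroup.card_mul_relIndex_of_le [Finite G] {A B : Subgroup G} (h : A ≤ B) :
    Nat.card A * A.relIndex B = Nat.card B := by
  have := Subgroup.relIndex_mul_relIndex ⊥ A B bot_le h
  simpa [Subgroup.relIndex_bot_left] using this

lemma SimpleChain.le_card [Finite G] {K : Subgroup G} {m : ℕ} (h : SimpleChain p K m) :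
    m ≤ Nat.card K := by
  induction h with
  | bot => simp
  | @step A B m h1 h2 ih =>
    rw [← Subgroup.card_mul_relIndex_of_le h2.le]
    exact Nat.mul_le_mul ih (stepWeight_le p (Subgroup.relIndex_ne_zero_of_finite A B))

lemma SimpleChain.pos [Finite G] {K : Subgroup G} {m : ℕ} (h : SimpleChain p K m) : 0 < m := by
  induction h with
  | bot => simp
  | @step A B m h1 h2 ih =>
    exact Nat.mul_pos ih (stepWeight_pos p (Subgroup.relIndex_ne_zero_of_finite A B))

/-- The elements of `K` whose image lies in the image of `A` form `A` or `K`. -/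
lemma SimpleStep.dichotomy {A K : Subgroup G} (h : SimpleStep A K) (f : G →* H) :
    K ⊓ (A.map f).comap f = A ∨ K ⊓ (A.map f).comap f = K := by
  refine h.simple _ (le_inf h.le (Subgroup.le_comap_map f A)) inf_le_left ?_
  rintro k hk n ⟨hn, a, ha, han⟩
  refine ⟨K.mul_mem (K.mul_mem hk hn) (K.inv_mem hk), k * a * k⁻¹, h.conj k hk a ha, ?_⟩
  simp [han]

lemma SimpleStep.map {A K : Subgroup G} (h : SimpleStep A K) (f : G →* H) : SimpleStep (A.map f) (K.map f) := by
  refine ⟨Subgroup.map_mono h.le, ?_, ?_⟩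
  · rintro _ ⟨k, hk, rfl⟩ _ ⟨a, ha, rfl⟩
    exact ⟨k * a * k⁻¹, h.conj k hk a ha, by simp⟩
  · intro N h1 h2 h3
    have hKN : K ⊓ N.comap f = A ∨ K ⊓ N.comap f = K := by
      refine h.simple _ (le_inf h.le (Subgroup.map_le_iff_le_comap.1 h1)) inf_le_left ?_
      rintro k hk n ⟨hn, hn'⟩
      refine ⟨K.mul_mem (K.mul_mem hk hn) (K.inv_mem hk), ?_⟩
      have := h3 (f k) ⟨k, hk, rfl⟩ (f n) hn'
      simpa using this
    rcases hKN with hKN | hKN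
    · left
      refine le_antisymm ?_ h1
      intro n hn
      obtain ⟨k, hk, rfl⟩ := h2 hn
      exact ⟨k, hKN ▸ ⟨hk, hn⟩, rfl⟩
    · right
      refine le_antisymm h2 ?_
      rintro _ ⟨k, hk, rfl⟩
      rw [← hKN] at hk
      exact hk.2

lemma SimpleStep.relIndex_map {A K : Subgroup G} {f : G →* H}
    (hf : K ⊓ (A.map f).comap f = A) : (A.map f).relIndex (K.map f) = A.relIndex K := by
  rw [← Subgroup.relIndex_comap, ← Subgroup.inf_relIndex_left, hf]

/-- Here K = A(K ∩ ker f). If N is normal in K ∩ ker f and contains A ∩ ker f, then [A, N] ≤ A ∩ ker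
f ≤ N, so N is normal in K. Simplicity of K / A applied to AN decides N. -/
lemma SimpleStep.inf_ker {A K : Subgroup G} (h : SimpleStep A K) {f : G →* H}
    (hf : K ⊓ (A.map f).comap f = K) : SimpleStep (A ⊓ f.ker) (K ⊓ f.ker) := by
  refine ⟨inf_le_inf_right _ h.le, ?_, ?_⟩
  · rintro k ⟨hk, hk'⟩ a ⟨ha, ha'⟩
    refine ⟨h.conj k hk a ha, ?_⟩
    change f _ = 1
    change f _ = 1 at hk' ha'
    simp [hk', ha']
  · intro N h1 h2 h3
    have hAN : ∀ a ∈ A, ∀ n ∈ N, a * n * a⁻¹ ∈ N := by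
      intro a ha n hn
      have hn' := h2 hn
      have : a * n * a⁻¹ * n⁻¹ ∈ N := by
        refine h1 ⟨?_, ?_⟩
        · have := h.conj n hn'.1 a⁻¹ (A.inv_mem ha)
          have := A.mul_mem ha this
          simpa [mul_assoc] using this
        · have : f n = 1 := hn'.2
          simp [this]
      have := N.mul_mem this hn
      simpa using this
    have hKN : ∀ k ∈ K, ∀ n ∈ N, k * n * k⁻¹ ∈ N := by
      intro k hk n hn
      have hk2 := hk
      rw [← hf] at hk2
      obtain ⟨a, ha, hak⟩ := hk2.2
      have h4 := h3 (k * a⁻¹) ⟨K.mul_mem hk (K.inv_mem (h.le ha)), by simp [hak]⟩ _ (hAN a ha n hn)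
      simpa [mul_assoc] using h4
    have hAle : A ≤ Subgroup.normalizer (N : Set G) := by
      intro a ha
      rw [Subgroup.mem_normalizer_iff]
      intro n
      refine ⟨fun hn => hAN a ha n hn, fun hn => ?_⟩
      have := hAN a⁻¹ (A.inv_mem ha) _ hn
      simpa [mul_assoc] using this
    have hsup : ∀ x, x ∈ A ⊔ N ↔ ∃ a ∈ A, ∃ n ∈ N, a * n = x := by
      intro x
      rw [← SetLike.mem_coe, Subgroup.coe_mul_of_left_le_normalizer_right A N hAle, Set.mem_mul]
      rfl
    rcases h.simple (A ⊔ N) le_sup_left (sup_le h.le (h2.trans inf_le_left)) (by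
      intro k hk x hx
      obtain ⟨a, ha, n, hn, rfl⟩ := (hsup x).1 hx
      refine (hsup _).2 ⟨_, h.conj k hk a ha, _, hKN k hk n hn, by group⟩) with h5 | h5
    · left
      refine le_antisymm (le_inf ?_ (h2.trans inf_le_right)) h1
      rw [← h5]
      exact le_sup_right
    · right
      refine le_antisymm h2 ?_
      rintro x ⟨hx, hx'⟩
      rw [← h5] at hx
      obtain ⟨a, ha, n, hn, rfl⟩ := (hsup x).1 hx
      refine N.mul_mem (h1 ⟨ha, ?_⟩) hn
      have h6 : f n = 1 := (h2 hn).2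
      change f _ = 1 at hx'
      change f _ = 1
      simpa [h6] using hx'

lemma Subgroup.card_inf_ker_mul_card_map [Finite G] (K : Subgroup G) (f : G →* H) :
    Nat.card ↥(K ⊓ f.ker) * Nat.card (K.map f) = Nat.card K := by
  rw [← Subgroup.card_mul_relIndex_of_le (inf_le_left : K ⊓ f.ker ≤ K), Subgroup.inf_relIndex_left,
    Subgroup.relIndex_ker]

lemma SimpleStep.relIndex_inf_ker [Finite G] {A K : Subgroup G} (h : A ≤ K) {f : G →* H}
    (hf : A.map f = K.map f) : (A ⊓ f.ker).relIndex (K ⊓ f.ker) = A.relIndex K := by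
  have h1 := Subgroup.card_mul_relIndex_of_le (inf_le_inf_right f.ker h)
  have h2 := Subgroup.card_mul_relIndex_of_le h
  rw [← Subgroup.card_inf_ker_mul_card_map K f, ← Subgroup.card_inf_ker_mul_card_map A f, hf,
    ← h1] at h2
  have h3 : 0 < Nat.card ↥(A ⊓ f.ker) * Nat.card (K.map f) :=
    have := Finite.of_surjective _ (f.subgroupMap_surjective K)
    Nat.mul_pos Nat.card_pos Nat.card_pos
  refine Nat.eq_of_mul_eq_mul_left h3 ?_
  rw [h2]; ring

/-- A chain of `K` induces chains of the kernel and of the image of a homomorphism. -/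
theorem SimpleChain.exists_ker_map [Finite G] {K : Subgroup G} {m : ℕ} (h : SimpleChain p K m)
    (f : G →* H) :
    ∃ a b, SimpleChain p (K ⊓ f.ker) a ∧ SimpleChain p (K.map f) b ∧ m = a * b := by
  induction h with
  | bot => exact ⟨1, 1, by simpa using SimpleChain.bot, by simpa using SimpleChain.bot, rfl⟩
  | @step A K m h1 h2 ih =>
    obtain ⟨a, b, ha, hb, rfl⟩ := ih
    -- The group in the dichotomy is A(K ∩ ker f). If it is A, the kernel part does not grow and the
    -- factor passes to the image; if it is K, the image does not grow and the factor passes to the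
    -- kernel.
    rcases h2.dichotomy f with hf | hf
    · refine ⟨a, b * stepWeight p (A.relIndex K), ?_, ?_, by ring⟩
      · convert ha using 1
        refine le_antisymm (le_inf ?_ inf_le_right) (inf_le_inf_right _ h2.le)
        rintro k ⟨hk, hk'⟩
        have : k ∈ K ⊓ (A.map f).comap f := ⟨hk, by
          change f k = 1 at hk'
          change f k ∈ A.map f
          rw [hk']
          exact Subgroup.one_mem _⟩
        rwa [hf] at this
      · rw [← SimpleStep.relIndex_map hf]
        exact hb.step (h2.map f)
    · have hmap : A.map f = K.map f := by
        refine le_antisymm (Subgroup.map_mono h2.le) ?_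
        rw [Subgroup.map_le_iff_le_comap]
        exact inf_eq_left.1 hf
      refine ⟨a * stepWeight p (A.relIndex K), b, ?_, hmap ▸ hb, by ring⟩
      rw [← SimpleStep.relIndex_inf_ker h2.le hmap]
      exact ha.step (h2.inf_ker hf)

theorem SimpleChain.comap {K : Subgroup H} {m : ℕ} (h : SimpleChain p K m) {f : G →* H}
    (hf : Function.Injective f) (hK : K ≤ f.range) : SimpleChain p (K.comap f) m := by
  induction h with
  | bot =>
    rw [MonoidHom.comap_bot, (MonoidHom.ker_eq_bot_iff f).2 hf]
    exact SimpleChain.bot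
  | @step A K m h1 h2 ih =>
    have hr : (A.comap f).relIndex (K.comap f) = A.relIndex K := by
      rw [Subgroup.relIndex_comap, Subgroup.map_comap_eq_self hK]
    rw [← hr]
    refine (ih (h2.le.trans hK)).step ⟨Subgroup.comap_mono h2.le, ?_, ?_⟩
    · intro k hk a ha
      simpa using h2.conj _ hk _ ha
    · intro N h3 h4 h5
      have h6 : N.map f ≤ K := Subgroup.map_le_iff_le_comap.2 h4
      have h7 : A ≤ N.map f := by
        rw [← Subgroup.map_comap_eq_self (h2.le.trans hK)]
        exact Subgroup.map_mono h3
      rcases h2.simple (N.map f) h7 h6 (by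
        rintro k hk _ ⟨n, hn, rfl⟩
        obtain ⟨g, rfl⟩ := hK hk
        exact ⟨g * n * g⁻¹, h5 g hk n hn, by simp⟩) with h8 | h8
      · left; rw [← h8, Subgroup.comap_map_eq_self_of_injective hf]
      · right; rw [← h8, Subgroup.comap_map_eq_self_of_injective hf]

theorem SimpleChain.map_of_injective [Finite G] {K : Subgroup G} {m : ℕ} (h : SimpleChain p K m)
    {f : G →* H} (hf : Function.Injective f) : SimpleChain p (K.map f) m := by
  obtain ⟨a, b, ha, hb, rfl⟩ := h.exists_ker_map f
  have h1 := ha.le_card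
  have h2 := ha.pos
  rw [(MonoidHom.ker_eq_bot_iff f).2 hf] at h1
  simp at h1
  obtain rfl : a = 1 := by omega
  simpa using hb

end

/-! ### Bounds on weights in symmetric groups, direct powers and semidirect products. -/

section

lemma SimpleChain.eq_one_of_card_eq_two {G : Type*} [Group G] (hG : Nat.card G = 2) {K : Subgroup G}
    {m : ℕ} (h : SimpleChain False K m) : m = 1 := by
  have : Finite G := Nat.finite_of_card_ne_zero (by omega)
  induction h with
  | bot => rfl
  | @step A B m h1 h2 ih =>
    have h3 : A.relIndex B ∣ 2 := by
      rw [← hG]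
      exact (Dvd.intro_left _ (Subgroup.card_mul_relIndex_of_le h2.le)).trans
        (Subgroup.card_subgroup_dvd_card B)
    rcases (Nat.dvd_prime Nat.prime_two).1 h3 with h4 | h4 <;>
      simp [ih, h4, stepWeight, Nat.prime_two]

lemma SimpleChain.eq_one_of_isSimpleGroup {G : Type*} [Group G] [Finite G] [IsSimpleGroup G]
    (hG : ¬ (Nat.card G).Prime) {m : ℕ} (h : SimpleChain True (⊤ : Subgroup G) m) : m = 1 := by
  suffices H : ∀ (K : Subgroup G) (m : ℕ), SimpleChain True K m → K = ⊤ → m = 1 from H _ _ h rfl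
  intro K m h
  induction h with
  | bot => exact fun _ => rfl
  | @step A B m h1 h2 ih =>
    rintro rfl
    have hA : A.Normal := ⟨fun n hn g => h2.conj g trivial n hn⟩
    rcases hA.eq_bot_or_eq_top with rfl | rfl
    · have h3 := h1.le_card
      have h4 := h1.pos
      rw [Subgroup.card_bot] at h3
      obtain rfl : m = 1 := by omega
      simp [stepWeight, hG]
    · simp [ih rfl, stepWeight_one]

/-- The sign has image of order at most 2 and contributes nothing, so all the weight sits in the
intersection with the alternating group. -/
lemma SimpleChain.perm_le {α : Type*} [Fintype α] [DecidableEq α] [Nontrivial α]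
    {K : Subgroup (Equiv.Perm α)} {m : ℕ} (h : SimpleChain False K m) :
    m ≤ Nat.card (alternatingGroup α) ∧ (m = Nat.card (alternatingGroup α) →
      alternatingGroup α ≤ K) := by
  obtain ⟨a, b, ha, hb, rfl⟩ := h.exists_ker_map Equiv.Perm.sign
  rw [hb.eq_one_of_card_eq_two (by simp), mul_one]
  rw [← alternatingGroup_eq_sign_ker] at ha
  refine ⟨ha.le_card.trans (Subgroup.card_le_of_le inf_le_right), fun h1 => ?_⟩
  have h2 := ha.le_card
  rw [h1] at h2
  have := Subgroup.eq_of_le_of_card_ge (inf_le_right : K ⊓ alternatingGroup α ≤ _) h2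
  exact inf_eq_right.1 this

variable {p : Prop} {ι U : Type*} [Group U] [Finite U]

lemma MonoidHom.mulSingle_injective_const {ι U : Type*} [Group U] [DecidableEq ι] (j : ι) :
    Function.Injective (MonoidHom.mulSingle (fun _ : ι => U) j) := by
  intro a b h
  simpa using congrFun h j

/-- Forgetting coordinate `j` has the `j`-th factor as kernel. -/
lemma SimpleChain.pi_split [Finite ι] [DecidableEq ι] {B : Subgroup (ι → U)} {m : ℕ}
    (h : SimpleChain p B m) (j : ι) :
    ∃ a b, SimpleChain p (B.comap (MonoidHom.mulSingle (fun _ : ι => U) j)) a ∧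
      SimpleChain p (B.map (MonoidHom.pi fun i : {i // i ≠ j} =>
        Pi.evalMonoidHom (fun _ : ι => U) i.1)) b ∧ m = a * b := by
  obtain ⟨a, b, ha, hb, hm⟩ := h.exists_ker_map (MonoidHom.pi fun i : {i // i ≠ j} =>
        Pi.evalMonoidHom (fun _ : ι => U) i.1)
  refine ⟨a, b, ?_, hb, hm⟩
  have := ha.comap (f := MonoidHom.mulSingle (fun _ : ι => U) j) (MonoidHom.mulSingle_injective_const j) (by
    rintro u ⟨-, hu⟩
    refine ⟨u j, ?_⟩
    ext i
    by_cases hij : i = j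
    · subst hij; simp
    · have := congrFun hu ⟨i, hij⟩
      simp [hij]
      exact this.symm)
  convert this using 1
  ext u
  simp only [Subgroup.mem_comap, Subgroup.mem_inf, iff_self_and]
  intro _
  ext i
  exact Pi.mulSingle_eq_of_ne (M := fun _ => U) i.2 u

lemma card_ne_eq_of_card_eq_succ {ι : Type*} [Fintype ι] [DecidableEq ι] (j : ι) {n : ℕ}
    (h : Fintype.card ι = n + 1) : Fintype.card {i // i ≠ j} = n := by
  rw [Fintype.card_subtype_compl, h]
  simp

lemma SimpleChain.pi_le {M : ℕ} (hM : ∀ (K : Subgroup U) m, SimpleChain p K m → m ≤ M) (n : ℕ) :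
    ∀ {ι : Type} [Fintype ι] [DecidableEq ι], Fintype.card ι = n → ∀ (B : Subgroup (ι → U)) (m : ℕ),
      SimpleChain p B m → m ≤ M ^ n := by
  induction n with
  | zero =>
    intro ι _ _ hι B m h
    have : IsEmpty ι := Fintype.card_eq_zero_iff.1 hι
    refine h.le_card.trans ((Subgroup.card_le_card_group B).trans ?_)
    simp
  | succ n ih =>
    intro ι _ _ hι B m h
    obtain ⟨j⟩ : Nonempty ι := Fintype.card_pos_iff.1 (by omega)
    obtain ⟨a, b, ha, hb, rfl⟩ := h.pi_split j
    rw [pow_succ']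
    exact Nat.mul_le_mul (hM _ _ ha) (ih (card_ne_eq_of_card_eq_succ j hι) _ _ hb)

/-- A product of bounded factors attains the product of the bounds only if each factor attains its
own. Since `j` is split off as a kernel, this concerns the intersection with the coordinate, not
merely the projection to it. -/
lemma SimpleChain.pi_eq {M : ℕ} (hM : ∀ (K : Subgroup U) m, SimpleChain p K m → m ≤ M) {ι : Type}
    [Fintype ι] [DecidableEq ι] {B : Subgroup (ι → U)}
    (h : SimpleChain p B (M ^ Fintype.card ι)) (j : ι) :
    SimpleChain p (B.comap (MonoidHom.mulSingle (fun _ : ι => U) j)) M := by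
  obtain ⟨n, hn⟩ : ∃ n, Fintype.card ι = n + 1 :=
    Nat.exists_eq_succ_of_ne_zero (Fintype.card_pos_iff.2 ⟨j⟩).ne'
  obtain ⟨a, b, ha, hb, hm⟩ := h.pi_split j
  have h1 := hM _ _ ha
  have h2 := SimpleChain.pi_le hM n (card_ne_eq_of_card_eq_succ j hn) _ _ hb
  have h3 := ha.pos
  have h4 := hb.pos
  rw [hn, pow_succ'] at hm
  obtain rfl : a = M := by
    refine le_antisymm h1 ?_
    by_contra h5
    have : a * b < M * M ^ n := Nat.mul_lt_mul_of_lt_of_le (by omega) h2 (h4.trans_le h2)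
    omega
  exact ha

lemma SimpleChain.pi_top_eq_one (hU : ∀ m, SimpleChain p (⊤ : Subgroup U) m → m = 1) (n : ℕ) :
    ∀ {ι : Type} [Fintype ι] [DecidableEq ι], Fintype.card ι = n → ∀ (m : ℕ),
      SimpleChain p (⊤ : Subgroup (ι → U)) m → m = 1 := by
  induction n with
  | zero =>
    intro ι _ _ hι m h
    have : IsEmpty ι := Fintype.card_eq_zero_iff.1 hι
    have h1 := h.le_card.trans (Subgroup.card_le_card_group _)
    have h2 := h.pos
    simp at h1
    omega
  | succ n ih =>
    intro ι _ _ hι m h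
    obtain ⟨j⟩ : Nonempty ι := Fintype.card_pos_iff.1 (by omega)
    obtain ⟨a, b, ha, hb, rfl⟩ := h.pi_split j
    rw [Subgroup.map_top_of_surjective _ (by
      intro u
      refine ⟨fun i => if hi : i ≠ j then u ⟨i, hi⟩ else 1, ?_⟩
      ext i
      exact dif_pos i.2)] at hb
    rw [hU a (by simpa using ha), ih (card_ne_eq_of_card_eq_succ j hι) _ hb]

lemma SimpleChain.semidirect_split {N Q : Type*} [Group N] [Group Q] [Finite N] [Finite Q]
    {φ : Q →* MulAut N} {K : Subgroup (N ⋊[φ] Q)} {m : ℕ} (h : SimpleChain p K m) :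
    ∃ a b, SimpleChain p (K.comap SemidirectProduct.inl) a ∧
      SimpleChain p (K.map SemidirectProduct.rightHom) b ∧ m = a * b := by
  have : Finite (N ⋊[φ] Q) := Finite.of_equiv _ SemidirectProduct.equivProd.symm
  obtain ⟨a, b, ha, hb, hm⟩ := h.exists_ker_map (SemidirectProduct.rightHom (φ := φ))
  refine ⟨a, b, ?_, hb, hm⟩
  have := ha.comap (f := SemidirectProduct.inl (φ := φ)) SemidirectProduct.inl_injective (by
    rw [SemidirectProduct.range_inl_eq_ker_rightHom]
    exact inf_le_right)
  rwa [← SemidirectProduct.range_inl_eq_ker_rightHom, Subgroup.comap_inf,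
    show SemidirectProduct.inl.range.comap (SemidirectProduct.inl (φ := φ)) = ⊤ from
      eq_top_iff.2 fun x _ => ⟨x, rfl⟩, inf_top_eq] at this

/-! ### From composition series to weights. -/

lemma SimpleStep.of_isSimpleGroup {G : Type*} [Group G] {A K : Subgroup G} (h : A ≤ K)
    [hn : (A.subgroupOf K).Normal] [IsSimpleGroup (K ⧸ A.subgroupOf K)] : SimpleStep A K := by
  refine ⟨h, fun k hk a ha => ?_, fun N h1 h2 h3 => ?_⟩
  · exact hn.conj_mem ⟨a, h ha⟩ ha ⟨k, hk⟩
  · have hN : (N.subgroupOf K).Normal := ⟨fun n hn g => h3 g g.2 n hn⟩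
    have hq := hN.map (QuotientGroup.mk' (A.subgroupOf K)) (QuotientGroup.mk'_surjective _)
    have h4 : ((N.subgroupOf K).map (QuotientGroup.mk' (A.subgroupOf K))).comap
        (QuotientGroup.mk' (A.subgroupOf K)) = N.subgroupOf K := by
      rw [Subgroup.comap_map_eq, QuotientGroup.ker_mk', sup_eq_left]
      exact Subgroup.comap_mono h1
    rcases hq.eq_bot_or_eq_top with h5 | h5
    · left
      rw [h5, MonoidHom.comap_bot, QuotientGroup.ker_mk'] at h4
      refine le_antisymm (fun x hx => ?_) h1
      have : (⟨x, h2 hx⟩ : K) ∈ N.subgroupOf K := hx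
      rw [← h4] at this
      exact this
    · right
      rw [h5, Subgroup.comap_top] at h4
      refine le_antisymm h2 fun x hx => ?_
      have : (⟨x, hx⟩ : K) ∈ N.subgroupOf K := h4 ▸ trivial
      exact this

lemma GroupCompSeries.simpleChain {G : Type*} [Group G] (s : GroupCompSeries G) (p : Prop) :
    SimpleChain p (⊤ : Subgroup G) (∏ i, stepWeight p (Nat.card (s.factor i))) := by
  have key : ∀ (k : ℕ) (hk : k ≤ s.length), SimpleChain p (s.term ⟨k, by omega⟩)
      (∏ i : Fin k, stepWeight p (Nat.card (s.factor (i.castLE hk)))) := by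
    intro k
    induction k with
    | zero =>
      intro _
      have := s.term_zero
      change SimpleChain p (s.term 0) _
      rw [this]
      simpa using SimpleChain.bot
    | succ k ih =>
      intro hk
      have h1 := ih (by omega)
      have hi := s.normal ⟨k, hk⟩
      have hs := s.simple ⟨k, hk⟩
      rw [Fin.prod_univ_castSucc]
      exact h1.step (@SimpleStep.of_isSimpleGroup _ _ _ _ (s.le_succ ⟨k, hk⟩) hi hs)
  have := key s.length le_rfl
  rw [← s.term_last]
  exact this

lemma GroupCompSeries.prod_card {G : Type*} [Group G] [Finite G] (s : GroupCompSeries G) :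
    ∏ i, Nat.card (s.factor i) = Nat.card G := by
  have key : ∀ (k : ℕ) (hk : k ≤ s.length),
      ∏ i : Fin k, Nat.card (s.factor (i.castLE hk)) = Nat.card (s.term ⟨k, by omega⟩) := by
    intro k
    induction k with
    | zero =>
      intro _
      have := s.term_zero
      change _ = Nat.card (s.term 0)
      rw [this]
      simp
    | succ k ih =>
      intro hk
      have h1 := ih (by omega)
      rw [Fin.prod_univ_castSucc]
      refine Eq.trans ?_ (Subgroup.card_mul_relIndex_of_le (s.le_succ ⟨k, hk⟩))
      exact congrArg (· * _) h1
  have := key s.length le_rfl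
  rw [← Subgroup.card_top (G := G), ← s.term_last]
  exact this

/-- By `hB` the abelian factors of `B` contribute 1, so |B| is the product of its nonabelian
weights, and these all occur among the factors of `G`. -/
lemma ContainsCompFactors.exists_simpleChain {G B : Type*} [Group G] [Group B] [Finite G] [Finite B]
    (h : ContainsCompFactors G B) (hB : ∀ m, SimpleChain True (⊤ : Subgroup B) m → m = 1) :
    ∃ m, Nat.card B ≤ m ∧ SimpleChain False (⊤ : Subgroup G) m := by
  obtain ⟨s, t, σ, hσ⟩ := h
  refine ⟨_, ?_, s.simpleChain False⟩
  have h1 : ∏ i, stepWeight False (Nat.card (t.factor i)) = Nat.card B := by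
    rw [← t.prod_card, ← one_mul (∏ i, stepWeight False _), ← hB _ (t.simpleChain True),
      ← Finset.prod_mul_distrib]
    exact Finset.prod_congr rfl fun i _ => stepWeight_true_mul_false _
  rw [← h1]
  calc _ = ∏ i, stepWeight False (Nat.card (s.factor (σ i))) := by
        refine Finset.prod_congr rfl fun i _ => ?_
        rw [Nat.card_congr (hσ i).some.toEquiv]
    _ = ∏ i ∈ Finset.univ.map σ, stepWeight False (Nat.card (s.factor i)) := by
        rw [Finset.prod_map]
    _ ≤ _ := by
        refine Finset.prod_le_prod_of_subset_of_one_le' (Finset.subset_univ _) fun i _ _ => ?_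
        exact stepWeight_pos _ (Subgroup.relIndex_ne_zero_of_finite (s.term i.castSucc) (s.term i.succ))

end

/-! ### Gluing conjugated 3-cycles into a conjugated alternating group. -/

section

open Equiv

variable {U α : Type*} [Group U]

/-- The base group of the wreath product with the full symmetric group. -/
def baseHom : (α → U) →* PermWreath U α (⊤ : Subgroup (Perm α)) := SemidirectProduct.inl

/-- The symmetric group as the standard complement of the base group. -/
def topHom : Perm α →* PermWreath U α (⊤ : Subgroup (Perm α)) :=
  SemidirectProduct.inr.comp (Subgroup.topEquiv (G := Perm α)).symm.toMonoidHom

lemma topHom_mul_baseHom_mul_inv (σ : Perm α) (u : α → U) :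
    topHom σ * baseHom u * (topHom σ)⁻¹ = baseHom (fun j => u (σ⁻¹ j)) := by
  have := SemidirectProduct.inl_aut (φ := (mulAutArrow : (⊤ : Subgroup (Perm α)) →* MulAut (α → U)))
    ⟨σ, trivial⟩ u
  rw [map_inv] at this
  exact this.symm

lemma topHom_mul_baseHom (σ : Perm α) (u : α → U) :
    topHom σ * baseHom u = baseHom (fun j => u (σ⁻¹ j)) * topHom σ := by
  rw [← topHom_mul_baseHom_mul_inv]; group

lemma rightHom_baseHom_mul_topHom (u : α → U) (σ : Perm α) :
    SemidirectProduct.rightHom (baseHom u * topHom σ) = ⟨σ, trivial⟩ := by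
  simp only [map_mul, baseHom, topHom, SemidirectProduct.rightHom_inl, one_mul]
  rfl

lemma baseHom_injective : Function.Injective (baseHom : (α → U) →* _) :=
  SemidirectProduct.inl_injective

/-- The permutations whose conjugate by the base element `v⁻¹` lies in `G`. -/
def twistedTop (G : Subgroup (PermWreath U α (⊤ : Subgroup (Perm α)))) (v : α → U) :
    Subgroup (Perm α) :=
  G.comap ((MulAut.conj (baseHom v)⁻¹).toMonoidHom.comp topHom)

/-- The conjugate of `G` by the base element `v`. -/
def baseConj (G : Subgroup (PermWreath U α (⊤ : Subgroup (Perm α)))) (v : α → U) :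
    Subgroup (PermWreath U α (⊤ : Subgroup (Perm α))) :=
  G.comap (MulAut.conj (baseHom v)⁻¹).toMonoidHom

variable {G : Subgroup (PermWreath U α (⊤ : Subgroup (Perm α)))} {v w z : α → U} {σ τ : Perm α}

lemma mem_twistedTop : σ ∈ twistedTop G v ↔ (baseHom v)⁻¹ * topHom σ * baseHom v ∈ G := by
  simp [twistedTop, Subgroup.mem_comap]

lemma mem_twistedTop_one : σ ∈ twistedTop G 1 ↔ topHom σ ∈ G := by
  simp [mem_twistedTop]

lemma twistedTop_baseConj : twistedTop (baseConj G v) w = twistedTop G (w * v) := by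
  ext σ
  rw [mem_twistedTop, mem_twistedTop]
  simp [baseConj, Subgroup.mem_comap, mul_assoc]

/-- A base element constant on the cycles of `σ` commutes with `σ`. -/
lemma mem_twistedTop_mul (hz : ∀ j, z (σ j) = z j) :
    σ ∈ twistedTop G (z * w) ↔ σ ∈ twistedTop G w := by
  rw [mem_twistedTop, mem_twistedTop, map_mul]
  have h : topHom σ * baseHom z = baseHom z * topHom σ := by
    rw [topHom_mul_baseHom]
    congr 2
    ext j
    simpa using (hz (σ⁻¹ j)).symm
  have : (baseHom z * baseHom w)⁻¹ * topHom σ * (baseHom z * baseHom w) =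
      (baseHom w)⁻¹ * ((baseHom z)⁻¹ * (topHom σ * baseHom z)) * baseHom w := by group
  rw [this, h]
  simp

variable [DecidableEq α]

/-- The permutation `a ↦ b ↦ c ↦ a`. -/
def cyc3 (a b c : α) : Perm α := swap a b * swap b c

variable {a b c : α}

lemma cyc3_apply_of_ne {x : α} (ha : x ≠ a) (hb : x ≠ b) (hc : x ≠ c) : cyc3 a b c x = x := by
  simp [cyc3, swap_apply_of_ne_of_ne, *]

lemma cyc3_apply_left (hab : a ≠ b) (hac : a ≠ c) : cyc3 a b c a = b := by
  simp [cyc3, swap_apply_of_ne_of_ne, *]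

lemma cyc3_apply_mid (hac : a ≠ c) (hbc : b ≠ c) : cyc3 a b c b = c := by
  simp [cyc3, swap_apply_of_ne_of_ne, hac.symm, hbc.symm]

lemma cyc3_apply_right : cyc3 a b c c = a := by
  simp [cyc3]

lemma cyc3_inv : (cyc3 a b c)⁻¹ = cyc3 c b a := by
  simp [cyc3, swap_comm]

lemma cyc3_rotate (hab : a ≠ b) (hac : a ≠ c) (hbc : b ≠ c) : cyc3 a b c = cyc3 b c a := by
  ext x
  simp only [cyc3, Perm.mul_apply, swap_apply_def]
  split_ifs <;> simp_all

lemma cyc3_conj (τ : Perm α) : τ * cyc3 a b c * τ⁻¹ = cyc3 (τ a) (τ b) (τ c) := by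
  simp only [cyc3, swap_apply_apply]
  group

lemma cyc3_mul_cyc3 {x y : α} (hxy : x ≠ y) (hxb : x ≠ b) (hxc : x ≠ c) (hyb : y ≠ b) (hyc : y ≠ c)
    (hbc : b ≠ c) : cyc3 x b c * cyc3 c b y = cyc3 x b y := by
  ext t
  simp only [cyc3, Perm.mul_apply, swap_apply_def]
  split_ifs <;> simp_all

lemma isThreeCycle_eq_cyc3 [Fintype α] {σ : Perm α} (h : σ.IsThreeCycle) :
    ∃ a b c, a ≠ b ∧ a ≠ c ∧ b ≠ c ∧ σ = cyc3 a b c := by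
  obtain ⟨a, b, c, hab, hac, hbc, hs⟩ := Finset.card_eq_three.1 h.card_support
  have h3 : ∀ x, σ (σ (σ x)) = x := by
    intro x
    have : σ ^ 3 = 1 := by rw [← h.orderOf]; exact pow_orderOf_eq_one σ
    simpa [pow_succ] using congrArg (fun τ : Perm α => τ x) this
  have h4 : ∀ x, σ x ≠ x ↔ (x = a ∨ x = b ∨ x = c) := by
    intro x
    rw [← Perm.mem_support, hs]; simp
  have h5 := (h4 a).2 (by simp)
  have h6 : σ (σ a) ≠ σ a := fun h => h5 (σ.injective h)
  have h7 : σ (σ a) ≠ a := fun h => h5 (by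
    have := h3 a; rw [h] at this; exact this)
  refine ⟨a, σ a, σ (σ a), h5.symm, h7.symm, h6.symm, ?_⟩
  ext x
  by_cases hx : x = a ∨ x = σ a ∨ x = σ (σ a)
  · rcases hx with rfl | rfl | rfl
    · rw [cyc3_apply_left h5.symm h7.symm]
    · rw [cyc3_apply_mid h7.symm h6.symm]
    · rw [cyc3_apply_right, h3]
  · have h8 : σ x = x := by
      by_contra h9
      have e1 := (h4 x).1 h9
      have e2 := (h4 (σ a)).1 h6
      have e3 := (h4 (σ (σ a))).1 (by rw [h3]; exact h7.symm)
      grind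
    push Not at hx
    rw [cyc3_apply_of_ne hx.1 hx.2.1 hx.2.2, h8]

lemma alternatingGroup_le_of_cyc3 [Fintype α] {S : Subgroup (Perm α)}
    (h : ∀ a b c, a ≠ b → a ≠ c → b ≠ c → cyc3 a b c ∈ S) : alternatingGroup α ≤ S := by
  rw [← Perm.closure_three_cycles_eq_alternating, Subgroup.closure_le]
  intro σ hσ
  obtain ⟨a, b, c, h1, h2, h3, rfl⟩ := isThreeCycle_eq_cyc3 hσ
  exact h a b c h1 h2 h3

lemma cyc3_mem_alternatingGroup [Fintype α] (hab : a ≠ b) (hbc : b ≠ c) :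
    cyc3 a b c ∈ alternatingGroup α :=
  Perm.mul_mem_alternatingGroup_of_isSwap ⟨a, b, hab, rfl⟩ ⟨b, c, hbc, rfl⟩

/-- All 3-cycles on points of `T` lie in `S`. -/
def ContainsThreeCycles (S : Subgroup (Perm α)) (T : Finset α) : Prop :=
  ∀ x ∈ T, ∀ y ∈ T, ∀ z ∈ T, x ≠ y → x ≠ z → y ≠ z → cyc3 x y z ∈ S

lemma ContainsThreeCycles.insert_point {S : Subgroup (Perm α)} {T : Finset α}
    (hT : ContainsThreeCycles S T)
    (h : ∀ x ∈ T, ∀ y ∈ T, x ≠ y → cyc3 x y c ∈ S) : ContainsThreeCycles S (insert c T) := by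
  intro x hx y hy z hz hxy hxz hyz
  rw [Finset.mem_insert] at hx hy hz
  rcases hx with rfl | hx
  · rcases hy with rfl | hy
    · exact absurd rfl hxy
    · rcases hz with rfl | hz
      · exact absurd rfl hxz
      · rw [cyc3_rotate hxy hxz hyz]
        exact h _ hy _ hz hyz
  · rcases hy with rfl | hy
    · rcases hz with rfl | hz
      · exact absurd rfl hyz
      · rw [cyc3_rotate hxy hxz hyz, cyc3_rotate hyz hxy.symm hxz.symm]
        exact h _ hz _ hx hxz.symm
    · rcases hz with rfl | hz
      · exact h _ hx _ hy hxy
      · exact hT _ hx _ hy _ hz hxy hxz hyz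

/-- The quotient of (y b c) by (x b c) is the 3-cycle (y b x); exchanging `b` and `c` gives the
cycles through `c`. -/
lemma ContainsThreeCycles.insert_pair {S : Subgroup (Perm α)} {T : Finset α}
    (hT : ContainsThreeCycles S T) (hb : b ∉ T) (hc : c ∉ T) (hbc : b ≠ c)
    (h : ∀ x ∈ T, cyc3 x b c ∈ S) : ContainsThreeCycles S (insert c (insert b T)) := by
  have hne : ∀ x ∈ T, ∀ y, y ∉ T → x ≠ y := fun x hx y hy e => hy (e ▸ hx)
  have h1 : ∀ x ∈ T, ∀ y ∈ T, x ≠ y → cyc3 x y b ∈ S := by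
    intro x hx y hy hxy
    have := S.mul_mem (h y hy) (S.inv_mem (h x hx))
    rw [cyc3_inv, cyc3_mul_cyc3 hxy.symm (hne y hy _ hb) (hne y hy _ hc) (hne x hx _ hb)
      (hne x hx _ hc) hbc, cyc3_rotate (hne y hy _ hb) hxy.symm (hne x hx _ hb).symm,
      cyc3_rotate (hne x hx _ hb).symm (hne y hy _ hb).symm hxy] at this
    exact this
  have h2 : ∀ x ∈ T, cyc3 x c b ∈ S := by
    intro x hx
    have := S.inv_mem (h x hx)
    rwa [cyc3_inv, cyc3_rotate hbc.symm (hne x hx _ hc).symm (hne x hx _ hb).symm,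
      cyc3_rotate (hne x hx _ hb).symm hbc (hne x hx _ hc)] at this
  have h3 : ∀ x ∈ T, ∀ y ∈ T, x ≠ y → cyc3 x y c ∈ S := by
    intro x hx y hy hxy
    have := S.mul_mem (h2 y hy) (S.inv_mem (h2 x hx))
    rw [cyc3_inv, cyc3_mul_cyc3 hxy.symm (hne y hy _ hc) (hne y hy _ hb) (hne x hx _ hc)
      (hne x hx _ hb) hbc.symm, cyc3_rotate (hne y hy _ hc) hxy.symm (hne x hx _ hc).symm,
      cyc3_rotate (hne x hx _ hc).symm (hne y hy _ hc).symm hxy] at this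
    exact this
  refine (hT.insert_point h1).insert_point fun x hx y hy hxy => ?_
  rw [Finset.mem_insert] at hx hy
  rcases hx with rfl | hx
  · rcases hy with rfl | hy
    · exact absurd rfl hxy
    · rw [cyc3_rotate hxy hbc (hne y hy _ hc)]
      exact h2 y hy
  · rcases hy with rfl | hy
    · exact h x hx
    · exact h3 x hx y hy hxy

/-- Every 3-cycle is conjugate into `G` by a base element supported on two of its points. -/
def HasThreeCycleLifts (G : Subgroup (PermWreath U α (⊤ : Subgroup (Perm α)))) : Prop :=
  ∀ a b c, a ≠ b → a ≠ c → b ≠ c →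
    ∃ w : α → U, (∀ j, j ≠ b → j ≠ c → w j = 1) ∧ cyc3 a b c ∈ twistedTop G w

/-- The factor `z` is constant on the cycle, so it may be multiplied to `w` freely; it is chosen to
agree with `v` off `b` and `c`, so that `z * w * v⁻¹` keeps the required support. -/
lemma HasThreeCycleLifts.baseConj (h : HasThreeCycleLifts G) (v : α → U) :
    HasThreeCycleLifts (baseConj G v) := by
  intro a b c hab hac hbc
  obtain ⟨w, hw, hG⟩ := h a b c hab hac hbc
  let z : α → U := fun j => if j = a ∨ j = b ∨ j = c then v a else v j
  refine ⟨z * w * v⁻¹, ?_, ?_⟩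
  · intro j hb hc
    by_cases ha : j = a
    · subst ha
      simp [z, hw j hb hc]
    · simp [z, ha, hb, hc, hw j hb hc]
  · rw [twistedTop_baseConj, inv_mul_cancel_right, mem_twistedTop_mul]
    · exact hG
    · intro j
      by_cases hj : j = a ∨ j = b ∨ j = c
      · rcases hj with rfl | rfl | rfl
        · rw [cyc3_apply_left hab hac]; simp [z]
        · rw [cyc3_apply_mid hac hbc]; simp [z]
        · rw [cyc3_apply_right]; simp [z]
      · push Not at hj
        rw [cyc3_apply_of_ne hj.1 hj.2.1 hj.2.2]

lemma Finset.exists_mem_ne_four {T : Finset α} (hT : 5 ≤ T.card) (p q r s : α) :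
    ∃ e ∈ T, e ≠ p ∧ e ≠ q ∧ e ≠ r ∧ e ≠ s := by
  have h1 : ({p, q, r, s} : Finset α).card ≤ 4 := Finset.card_le_four
  obtain ⟨e, he, he'⟩ := Finset.exists_mem_notMem_of_card_lt_card (h1.trans_lt hT)
  exact ⟨e, he, by simpa using he'⟩

/-- If the 3-cycles `(x y c)` lie in `G` up to conjugation by an element `β` of the coordinate `y`,
they lie in `G`. -/
lemma cyc3_mem_of_twisted {T : Finset α} (hT : 5 ≤ T.card) (hc : c ∉ T) (β : U)
    (h : ∀ x ∈ T, ∀ y ∈ T, x ≠ y → cyc3 x y c ∈ twistedTop G (Pi.mulSingle y β)) :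
    ∀ x ∈ T, ∀ y ∈ T, x ≠ y → cyc3 x y c ∈ twistedTop G 1 := by
  have hne : ∀ x ∈ T, x ≠ c := fun x hx e => hc (e ▸ hx)
  let B : α → PermWreath U α (⊤ : Subgroup (Perm α)) := fun j => baseHom (Pi.mulSingle j β)
  have hB : ∀ i j, Commute (B i) (B j) := by
    intro i j
    by_cases hij : i = j
    · subst hij; exact Commute.refl _
    · exact (Pi.mulSingle_commute hij β β).map baseHom
  have hBt : ∀ σ j, topHom σ * B j = B (σ j) * topHom σ := by
    intro σ j
    rw [topHom_mul_baseHom]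
    congr 2
    ext i
    simp only [Pi.mulSingle_apply, Perm.inv_eq_iff_eq]
  have hG : ∀ x ∈ T, ∀ y ∈ T, x ≠ y → (B y)⁻¹ * topHom (cyc3 x y c) * B y ∈ G :=
    fun x hx y hy hxy => mem_twistedTop.1 (h x hx y hy hxy)
  -- The cycles (x y c) and (y x c) are inverse, so the product of their twisted forms lies in the
  -- base group. Comparing different `x` isolates the quotients of the `B j`, which undo the twist.
  have h1 : ∀ x ∈ T, ∀ y ∈ T, x ≠ y → (B y)⁻¹ * B c * ((B y)⁻¹ * B x) ∈ G := by
    intro x hx y hy hxy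
    have := G.mul_mem (hG x hx y hy hxy) (hG y hy x hx hxy.symm)
    have e : cyc3 y x c = (cyc3 x y c)⁻¹ := by
      rw [cyc3_inv, cyc3_rotate (hne y hy).symm (hne x hx).symm hxy.symm]
    have e1 : topHom (cyc3 x y c) * B y = B c * topHom (cyc3 x y c) := by
      rw [hBt, cyc3_apply_mid (hne x hx) (hne y hy)]
    have e2 : topHom (cyc3 x y c) * B x = B y * topHom (cyc3 x y c) := by
      rw [hBt, cyc3_apply_left hxy (hne x hx)]
    rw [e, map_inv] at this
    convert this using 1
    calc _ = (B y)⁻¹ * B c * (topHom (cyc3 x y c) * (B y * topHom (cyc3 x y c))⁻¹) * B x := by group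
      _ = (B y)⁻¹ * (B c * topHom (cyc3 x y c)) * ((topHom (cyc3 x y c) * B x)⁻¹) * B x := by
          rw [e2]; group
      _ = _ := by rw [← e1]; group
  have h2 : ∀ x ∈ T, ∀ e ∈ T, x ≠ e → (B e)⁻¹ * B x ∈ G := by
    intro x hx e he hxe
    obtain ⟨y, hy, hyx, hye, -⟩ := Finset.exists_mem_ne_four hT x e e e
    have := G.mul_mem (G.inv_mem (h1 e he y hy hye.symm)) (h1 x hx y hy hyx.symm)
    simpa [mul_assoc] using this
  intro x hx y hy hxy
  rw [mem_twistedTop_one]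
  have h3 : (B y)⁻¹ * B c ∈ G := by
    have := G.mul_mem (h1 x hx y hy hxy) (G.inv_mem (h2 x hx y hy hxy))
    simpa [mul_assoc] using this
  have h4 := G.mul_mem (G.inv_mem h3) (hG x hx y hy hxy)
  have e1 : topHom (cyc3 x y c) * B y = B c * topHom (cyc3 x y c) := by
    rw [hBt, cyc3_apply_mid (hne x hx) (hne y hy)]
  rw [mul_assoc (B y)⁻¹, e1] at h4
  simpa [mul_assoc] using h4

lemma HasThreeCycleLifts.exists_insert (h : HasThreeCycleLifts G) {T : Finset α} (hT : 5 ≤ T.card)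
    (hc : c ∉ T) (hG : ContainsThreeCycles (twistedTop G v) T) :
    ∃ v, ContainsThreeCycles (twistedTop G v) (insert c T) := by
  have hne : ∀ x ∈ T, x ≠ c := fun x hx e => hc (e ▸ hx)
  obtain ⟨a, ha, b, hb, hab⟩ := Finset.one_lt_card.1 (show 1 < T.card by omega)
  obtain ⟨w, hw, hwG⟩ := (h.baseConj v) a b c hab (hne a ha) (hne b hb)
  -- The 3-cycles on `T` fix `c`, so `v` can be altered at `c` at no cost. This absorbs the
  -- `c`-coordinate of `w` and leaves a twist at `b` only.
  refine ⟨Pi.mulSingle c (w c) * v, ?_⟩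
  have hT1 : ContainsThreeCycles (twistedTop G (Pi.mulSingle c (w c) * v)) T := by
    intro x hx y hy z hz hxy hxz hyz
    rw [mem_twistedTop_mul]
    · exact hG x hx y hy z hz hxy hxz hyz
    · intro j
      by_cases hj : j = c
      · rw [hj, cyc3_apply_of_ne (hne x hx).symm (hne y hy).symm (hne z hz).symm]
      · rw [Pi.mulSingle_eq_of_ne hj, Pi.mulSingle_eq_of_ne]
        intro h1
        apply hj
        rw [← cyc3_apply_of_ne (hne x hx).symm (hne y hy).symm (hne z hz).symm] at h1
        exact (cyc3 x y z).injective h1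
  refine hT1.insert_point ?_
  set G' := _root_.baseConj G (Pi.mulSingle c (w c) * v) with hG'
  have hG1 : twistedTop G (Pi.mulSingle c (w c) * v) = twistedTop G' 1 := by
    rw [twistedTop_baseConj, one_mul]
  rw [hG1] at hT1 ⊢
  have hab' : cyc3 a b c ∈ twistedTop G' (Pi.mulSingle b (w b)) := by
    rw [twistedTop_baseConj, ← mul_assoc, ← twistedTop_baseConj]
    convert hwG using 2
    ext j
    by_cases hjb : j = b
    · subst hjb; simp [hne j hb]
    · by_cases hjc : j = c
      · subst hjc; simp [hjb]
      · simp [hjb, hjc, hw j hjb hjc]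
  generalize w b = β at hab'
  refine cyc3_mem_of_twisted hT hc β ?_
  -- Conjugation by untwisted 3-cycles on `T` carries the one known cycle (a b c), with its twist
  -- `β`, to every (x y c).
  have hconj : ∀ x y τ, τ ∈ twistedTop G' 1 → τ c = c →
      cyc3 x y c ∈ twistedTop G' (Pi.mulSingle y β) →
      cyc3 (τ x) (τ y) c ∈ twistedTop G' (Pi.mulSingle (τ y) β) := by
    intro x y τ hτ hτc hxy
    rw [mem_twistedTop_one] at hτ
    rw [mem_twistedTop] at hxy ⊢
    have := G'.mul_mem (G'.mul_mem hτ hxy) (G'.inv_mem hτ)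
    convert this using 1
    have e : topHom τ * baseHom (Pi.mulSingle y β) * (topHom τ)⁻¹ =
        baseHom (Pi.mulSingle (τ y) β) := by
      rw [topHom_mul_baseHom_mul_inv]
      congr 1
      ext i
      simp only [Pi.mulSingle_apply, Perm.inv_eq_iff_eq]
    have e2 := cyc3_conj (a := x) (b := y) (c := c) τ
    rw [hτc] at e2
    rw [← e, ← e2, map_mul, map_mul, map_inv]
    group
  have hright : ∀ x ∈ T, ∀ y ∈ T, ∀ e ∈ T, x ≠ y → x ≠ e →
      cyc3 x y c ∈ twistedTop G' (Pi.mulSingle y β) →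
      cyc3 x e c ∈ twistedTop G' (Pi.mulSingle e β) := by
    intro x hx y hy e he hxy hxe h1
    by_cases hye : y = e
    · subst hye; exact h1
    obtain ⟨f, hf, hfx, hfy, hfe, -⟩ := Finset.exists_mem_ne_four hT x y e e
    have := hconj x y (cyc3 y e f) (hT1 y hy e he f hf hye hfy.symm hfe.symm)
      (cyc3_apply_of_ne (hne y hy).symm (hne e he).symm (hne f hf).symm) h1
    rwa [cyc3_apply_of_ne hxy hxe hfx.symm, cyc3_apply_left hye hfy.symm] at this
  have hleft : ∀ x ∈ T, ∀ y ∈ T, ∀ e ∈ T, x ≠ y → y ≠ e →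
      cyc3 x y c ∈ twistedTop G' (Pi.mulSingle y β) →
      cyc3 e y c ∈ twistedTop G' (Pi.mulSingle y β) := by
    intro x hx y hy e he hxy hye h1
    by_cases hxe : x = e
    · subst hxe; exact h1
    obtain ⟨f, hf, hfx, hfy, hfe, -⟩ := Finset.exists_mem_ne_four hT x y e e
    have := hconj x y (cyc3 x e f) (hT1 x hx e he f hf hxe hfx.symm hfe.symm)
      (cyc3_apply_of_ne (hne x hx).symm (hne e he).symm (hne f hf).symm) h1
    rwa [cyc3_apply_of_ne hxy.symm hye hfy.symm, cyc3_apply_left hxe hfx.symm] at this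
  intro x hx y hy hxy
  -- The route (a, b), (a, e), (x, e), (x, y) through a fresh point `e` avoids collisions such as x
  -- = b.
  obtain ⟨e, he, hea, heb, hex, hey⟩ := Finset.exists_mem_ne_four hT a b x y
  exact hright x hx e he y hy hex.symm hxy
    (hleft a ha e he x hx hea.symm hex (hright a ha b hb e he hab hea.symm hab'))

/-- Two 3-cycles sharing the single point `p 2` yield all 3-cycles on the five points. The second
correction `u` is supported on `p 3` and `p 4`, so it does not disturb the first cycle. -/
lemma HasThreeCycleLifts.exists_five (h : HasThreeCycleLifts G) (p : Fin 5 ↪ α) :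
    ∃ v, ContainsThreeCycles (twistedTop G v) (Finset.univ.map p) := by
  have hp : ∀ i j, i ≠ j → p i ≠ p j := fun i j hij e => hij (p.injective e)
  obtain ⟨w, -, hwG⟩ := h (p 0) (p 1) (p 2) (hp _ _ (by decide)) (hp _ _ (by decide))
    (hp _ _ (by decide))
  obtain ⟨u, hu, huG⟩ := (h.baseConj w) (p 2) (p 3) (p 4) (hp _ _ (by decide)) (hp _ _ (by decide))
    (hp _ _ (by decide))
  refine ⟨u * w, ?_⟩
  rw [twistedTop_baseConj] at huG
  rw [← mem_twistedTop_mul (z := u)] at hwG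
  swap
  · intro j
    by_cases hj : j = p 0 ∨ j = p 1 ∨ j = p 2
    · have h1 : ∀ i : Fin 5, i = 0 ∨ i = 1 ∨ i = 2 → u (p i) = 1 := fun i hi =>
        hu _ (hp _ _ (by revert hi; revert i; decide)) (hp _ _ (by revert hi; revert i; decide))
      rcases hj with rfl | rfl | rfl
      · rw [cyc3_apply_left (hp _ _ (by decide)) (hp _ _ (by decide)), h1, h1] <;> decide
      · rw [cyc3_apply_mid (hp _ _ (by decide)) (hp _ _ (by decide)), h1, h1] <;> decide
      · rw [cyc3_apply_right, h1, h1] <;> decide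
    · push Not at hj
      rw [cyc3_apply_of_ne hj.1 hj.2.1 hj.2.2]
  generalize twistedTop G (u * w) = S at *
  have hT : ContainsThreeCycles S {p 0, p 1, p 2} := by
    have h01 := hp 0 1 (by decide)
    have h02 := hp 0 2 (by decide)
    have h12 := hp 1 2 (by decide)
    have hinv := S.inv_mem hwG
    rw [cyc3_inv] at hinv
    have e1 := cyc3_rotate h01 h02 h12
    have e2 := cyc3_rotate h12 h01.symm h02.symm
    have e3 := cyc3_rotate h12.symm h02.symm h01.symm
    have e4 := cyc3_rotate h01.symm h12 h02
    intro x hx y hy z hz hxy hxz hyz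
    simp only [Finset.mem_insert, Finset.mem_singleton] at hx hy hz
    rcases hx with rfl | rfl | rfl <;> rcases hy with rfl | rfl | rfl <;>
      rcases hz with rfl | rfl | rfl <;> simp_all
  have h4 : cyc3 (p 0) (p 3) (p 4) ∈ S := by
    have := S.mul_mem (S.mul_mem hwG huG) (S.inv_mem hwG)
    rwa [cyc3_conj, cyc3_apply_right, cyc3_apply_of_ne, cyc3_apply_of_ne] at this <;>
      exact hp _ _ (by decide)
  have h5 : cyc3 (p 1) (p 3) (p 4) ∈ S := by
    have := S.mul_mem (S.mul_mem hwG h4) (S.inv_mem hwG)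
    rwa [cyc3_conj, cyc3_apply_left, cyc3_apply_of_ne, cyc3_apply_of_ne] at this <;>
      exact hp _ _ (by decide)
  have h6 := hT.insert_pair (b := p 3) (c := p 4) (by simp [p.injective.eq_iff])
    (by simp [p.injective.eq_iff]) (hp _ _ (by decide)) (by
      intro x hx
      simp only [Finset.mem_insert, Finset.mem_singleton] at hx
      rcases hx with rfl | rfl | rfl <;> assumption)
  convert h6 using 1
  ext x
  simp [Fin.exists_fin_succ]
  grind

theorem HasThreeCycleLifts.exists_alternatingGroup_le [Fintype α] (hα : 5 ≤ Fintype.card α)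
    (h : HasThreeCycleLifts G) : ∃ v, alternatingGroup α ≤ twistedTop G v := by
  have key : ∀ k, 5 + k ≤ Fintype.card α → ∃ T : Finset α, T.card = 5 + k ∧
      ∃ v, ContainsThreeCycles (twistedTop G v) T := by
    intro k
    induction k with
    | zero =>
      intro _
      obtain ⟨p⟩ : Nonempty (Fin 5 ↪ α) := Function.Embedding.nonempty_of_card_le (by simpa using hα)
      exact ⟨_, by simp, h.exists_five p⟩
    | succ k ih =>
      intro hk
      obtain ⟨T, hT, v, hv⟩ := ih (by omega)
      obtain ⟨c, hc⟩ : ∃ c, c ∉ T := by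
        by_contra! h1
        rw [Finset.eq_univ_of_forall h1, Finset.card_univ] at hT
        omega
      exact ⟨insert c T, by rw [Finset.card_insert_of_notMem hc, hT]; ring,
        h.exists_insert (by omega) hc hv⟩
  obtain ⟨T, hT, v, hv⟩ := key (Fintype.card α - 5) (by omega)
  have hT' : T = Finset.univ := Finset.eq_univ_of_card T (by omega)
  subst hT'
  exact ⟨v, alternatingGroup_le_of_cyc3 fun a b c => hv a (by simp) b (by simp) c (by simp)⟩

end

/-! ### Lifting 3-cycles by elements of 3-power order. -/

section

open Equiv

/-- The subgroup generated by the elements of `K` of 3-power order. -/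
def threeCore {U : Type*} [Group U] (K : Subgroup U) : Subgroup U :=
  Subgroup.closure {x | x ∈ K ∧ ∃ k : ℕ, x ^ 3 ^ k = 1}

section

variable {U V : Type*} [Group U] [Group V]

lemma threeCore_le (K : Subgroup U) : threeCore K ≤ K := by
  rw [threeCore, Subgroup.closure_le]
  exact fun x hx => hx.1

lemma mem_threeCore {K : Subgroup U} {x : U} {k : ℕ} (hx : x ∈ K) (h : x ^ 3 ^ k = 1) :
    x ∈ threeCore K :=
  Subgroup.subset_closure ⟨hx, k, h⟩

lemma threeCore_le_comap {K : Subgroup U} {L : Subgroup V} {f : U →* V} (h : K ≤ L.comap f) :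
    threeCore K ≤ (threeCore L).comap f := by
  rw [threeCore, Subgroup.closure_le]
  rintro x ⟨hx, k, hk⟩
  exact mem_threeCore (k := k) (h hx) (by rw [← map_pow, hk, map_one])

/-- In the normalizer of `R` modulo `R`, the class of `x` has order dividing both a power of 3 and a
power of 2. -/
lemma mem_of_pow_three_pow_eq_one [Finite U] {R : Subgroup U} {n k : ℕ}
    (hR : Nat.card U ∣ Nat.card R * 2 ^ n) {x : U} (hx : ∀ r ∈ R, x * r * x⁻¹ ∈ R)
    (hxk : x ^ 3 ^ k = 1) : x ∈ R := by
  have hxN : x ∈ Subgroup.normalizer (R : Set U) := Subgroup.mem_normalizer_fintype hx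
  set N := Subgroup.normalizer (R : Set U)
  have hRN : R ≤ N := Subgroup.le_normalizer
  have hnormal : (R.subgroupOf N).Normal := Subgroup.normal_in_normalizer
  let q : N ⧸ R.subgroupOf N := QuotientGroup.mk' _ ⟨x, hxN⟩
  have h1 : orderOf q ∣ 3 ^ k := by
    apply orderOf_dvd_of_pow_eq_one
    rw [← map_pow]
    have : (⟨x, hxN⟩ : N) ^ 3 ^ k = 1 := Subtype.ext hxk
    rw [this, map_one]
  have h2 : orderOf q ∣ 2 ^ n := by
    refine (orderOf_dvd_natCard q).trans ?_
    refine Nat.dvd_of_mul_dvd_mul_left (Nat.card_pos (α := R)) (dvd_trans ?_ hR)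
    change Nat.card R * R.relIndex N ∣ _
    rw [Subgroup.card_mul_relIndex_of_le hRN]
    exact Subgroup.card_subgroup_dvd_card N
  have h3 : orderOf q = 1 :=
    Nat.eq_one_of_dvd_coprimes (Nat.Coprime.pow k n (by norm_num : Nat.Coprime 3 2)) h1 h2
  rw [orderOf_eq_one_iff] at h3
  exact (QuotientGroup.eq_one_iff (N := R.subgroupOf N) (⟨x, hxN⟩ : N)).1 h3

end

section

variable {U α : Type*} [Group U]

/-- The projection of the wreath product to the symmetric group. -/
def permHom : PermWreath U α (⊤ : Subgroup (Perm α)) →* Perm α :=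
  (Subgroup.subtype _).comp SemidirectProduct.rightHom

lemma permHom_baseHom_mul_topHom (u : α → U) (σ : Perm α) :
    permHom (baseHom u * topHom σ) = σ := by
  rw [permHom, MonoidHom.comp_apply, rightHom_baseHom_mul_topHom]
  rfl

lemma eq_baseHom_left_mul_topHom (g : PermWreath U α (⊤ : Subgroup (Perm α))) :
    g = baseHom g.left * topHom (permHom g) :=
  (SemidirectProduct.inl_left_mul_inr_right g).symm

lemma left_mul_apply (g h : PermWreath U α (⊤ : Subgroup (Perm α))) (j : α) :
    (g * h).left j = g.left j * h.left ((permHom g)⁻¹ j) := rfl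

lemma left_pow_apply {g : PermWreath U α (⊤ : Subgroup (Perm α))} {j : α} (hj : permHom g j = j)
    (n : ℕ) : (g ^ n).left j = g.left j ^ n := by
  induction n with
  | zero => simp
  | succ n ih =>
    rw [pow_succ', left_mul_apply, pow_succ', Perm.inv_eq_iff_eq.2 hj.symm, ih]

lemma exists_three_power_lift [Finite U] [Finite α]
    {G : Subgroup (PermWreath U α (⊤ : Subgroup (Perm α)))} {σ : Perm α} (hσ : σ ^ 3 = 1) (h : σ ∈ G.map permHom) :
    ∃ g ∈ G, permHom g = σ ∧ ∃ k : ℕ, g ^ 3 ^ k = 1 := by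
  have : Finite (PermWreath U α (⊤ : Subgroup (Perm α))) :=
    Finite.of_equiv _ SemidirectProduct.equivProd.symm
  obtain ⟨g, hg, rfl⟩ := h
  obtain ⟨k, m, hm, hkm⟩ := Nat.exists_eq_pow_mul_and_not_dvd (orderOf_pos g).ne' 3 (by norm_num)
  have hcop : Nat.Coprime 3 m := (Nat.Prime.coprime_iff_not_dvd Nat.prime_three).2 hm
  -- The power `g ^ e` loses the part of the order prime to 3, while e ≡ 1 mod 3 preserves the image
  -- `σ`.
  obtain ⟨e, he3, hem⟩ := Nat.chineseRemainder hcop 1 0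
  refine ⟨g ^ e, G.pow_mem hg e, ?_, k, ?_⟩
  · rw [map_pow]
    have h1 : permHom g ^ e = permHom g ^ 1 :=
      pow_eq_pow_iff_modEq.2 (he3.of_dvd (orderOf_dvd_of_pow_eq_one hσ))
    rw [h1, pow_one]
  · rw [← pow_mul, ← orderOf_dvd_iff_pow_eq_one, hkm, mul_comm]
    exact Nat.mul_dvd_mul_right ((Nat.modEq_zero_iff_dvd).1 hem) _

variable [DecidableEq α] (G : Subgroup (PermWreath U α (⊤ : Subgroup (Perm α))))

/-- The intersection of `G` with the `j`-th coordinate of the base group. -/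
def coordSubgroup (j : α) : Subgroup U :=
  G.comap (baseHom.comp (MonoidHom.mulSingle (fun _ : α => U) j))

variable {G}

lemma mem_coordSubgroup {j : α} {x : U} :
    x ∈ coordSubgroup G j ↔ baseHom (Pi.mulSingle j x) ∈ G := Iff.rfl

lemma baseHom_mem [Finite α] {u : α → U} (h : ∀ j, u j ∈ coordSubgroup G j) : baseHom u ∈ G :=
  Subgroup.pi_mem_of_mulSingle_mem (H := G.comap baseHom) u h

lemma conj_baseHom_mulSingle (g : PermWreath U α (⊤ : Subgroup (Perm α))) (j : α) (x : U) :
    g * baseHom (Pi.mulSingle j x) * g⁻¹ = baseHom (Pi.mulSingle (permHom g j)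
      (g.left (permHom g j) * x * (g.left (permHom g j))⁻¹)) := by
  set σ := permHom g with hσ
  set u := g.left with hu
  have hg : g = baseHom u * topHom σ := eq_baseHom_left_mul_topHom g
  rw [hg]
  calc _ = baseHom u * (topHom σ * baseHom (Pi.mulSingle j x) * (topHom σ)⁻¹) * (baseHom u)⁻¹ := by
        group
    _ = _ := by
        rw [topHom_mul_baseHom_mul_inv, ← map_mul, ← map_inv baseHom u, ← map_mul]
        congr 1
        ext i
        by_cases hi : i = σ j
        · subst hi; simp
        · have : σ⁻¹ i ≠ j := fun h => hi (Perm.inv_eq_iff_eq.1 h)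
          simpa [hi] using Pi.mulSingle_eq_of_ne (M := fun _ => U) this x

lemma conj_mem_coordSubgroup {g : PermWreath U α (⊤ : Subgroup (Perm α))} (hg : g ∈ G) {j : α}
    {x : U} (hx : x ∈ coordSubgroup G j) : g.left (permHom g j) * x * (g.left (permHom g j))⁻¹ ∈
      coordSubgroup G (permHom g j) := by
  rw [mem_coordSubgroup, ← conj_baseHom_mulSingle]
  exact G.mul_mem (G.mul_mem hg hx) (G.inv_mem hg)

lemma conj_mem_threeCore_coordSubgroup {g : PermWreath U α (⊤ : Subgroup (Perm α))} (hg : g ∈ G)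
    {j : α} (hj : permHom g j = j) {x : U} (hx : x ∈ threeCore (coordSubgroup G j)) :
    g.left j * x * (g.left j)⁻¹ ∈ threeCore (coordSubgroup G j) := by
  refine threeCore_le_comap (f := (MulAut.conj (g.left j)).toMonoidHom)
    (K := coordSubgroup G j) (fun y hy => ?_) hx
  have := conj_mem_coordSubgroup hg hy
  rw [hj] at this
  exact this

lemma cyc3_pow_three {a b c : α} (hab : a ≠ b) (hac : a ≠ c) (hbc : b ≠ c) : cyc3 a b c ^ 3 = 1 := by
  ext x
  rw [pow_succ, pow_two]
  simp only [Perm.mul_apply, Perm.one_apply]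
  by_cases ha : x = a
  · subst ha
    rw [cyc3_apply_left hab hac, cyc3_apply_mid hac hbc, cyc3_apply_right]
  · by_cases hb : x = b
    · subst hb
      rw [cyc3_apply_mid hac hbc, cyc3_apply_right, cyc3_apply_left hab hac]
    · by_cases hc : x = c
      · subst hc
        rw [cyc3_apply_right, cyc3_apply_left hab hac, cyc3_apply_mid hac hbc]
      · rw [cyc3_apply_of_ne ha hb hc, cyc3_apply_of_ne ha hb hc, cyc3_apply_of_ne ha hb hc]

/-- Take a lift `g` of 3-power order. Its coordinates at fixed points, and the coordinate at `a` of
its cube, have 3-power order and normalize the 3-cores there, so they lie in `G`. Dividing them out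
makes `g` trivial off the cycle, with trivial product around it, hence conjugate to the bare cycle.
-/
theorem hasThreeCycleLifts_of_card_dvd [Finite U] [Fintype α]
    (hG : alternatingGroup α ≤ G.map permHom)
    (hR : ∀ j, ∃ n, Nat.card U ∣ Nat.card (threeCore (coordSubgroup G j)) * 2 ^ n) :
    HasThreeCycleLifts G := by
  intro a b c hab hac hbc
  obtain ⟨g, hg, hgσ, k, hk⟩ := exists_three_power_lift (cyc3_pow_three hab hac hbc)
    (hG (cyc3_mem_alternatingGroup hab hbc))
  have hmem : ∀ (h : PermWreath U α (⊤ : Subgroup (Perm α))) (j : α), h ∈ G → permHom h j = j →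
      h ^ 3 ^ k = 1 → h.left j ∈ coordSubgroup G j := by
    intro h j hh hj hhk
    obtain ⟨n, hn⟩ := hR j
    refine threeCore_le _ (mem_of_pow_three_pow_eq_one hn (k := k)
      (fun r hr => conj_mem_threeCore_coordSubgroup hh hj hr) ?_)
    rw [← left_pow_apply hj, hhk]
    rfl
  set u := g.left with hu
  have ia : (cyc3 a b c)⁻¹ a = c := Perm.inv_eq_iff_eq.2 cyc3_apply_right.symm
  have ib : (cyc3 a b c)⁻¹ b = a := Perm.inv_eq_iff_eq.2 (cyc3_apply_left hab hac).symm
  have ic : (cyc3 a b c)⁻¹ c = b := Perm.inv_eq_iff_eq.2 (cyc3_apply_mid hac hbc).symm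
  have hy : u a * (u c * u b) ∈ coordSubgroup G a := by
    have := hmem (g * (g * g)) a (G.mul_mem hg (G.mul_mem hg hg)) (by
      rw [map_mul, map_mul, hgσ, ← pow_two, ← pow_succ', cyc3_pow_three hab hac hbc]
      rfl) (by
      rw [← pow_two, ← pow_succ', ← pow_mul, mul_comm, pow_mul, hk, one_pow])
    rw [left_mul_apply, left_mul_apply, hgσ, ia, ic] at this
    exact this
  have hfix : ∀ j, j ≠ a → j ≠ b → j ≠ c → u j ∈ coordSubgroup G j := fun j ha hb hc =>
    hmem g j hg (by rw [hgσ, cyc3_apply_of_ne ha hb hc]) hk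
  let r : α → U := fun j => if j = a then (u a * (u c * u b))⁻¹ else
    if j = b then 1 else if j = c then 1 else (u j)⁻¹
  have hr : baseHom r ∈ G := by
    refine baseHom_mem fun j => ?_
    simp only [r]
    split_ifs with h1 h2 h3
    · subst h1; exact inv_mem hy
    · exact one_mem _
    · exact one_mem _
    · exact inv_mem (hfix j h1 h2 h3)
  -- Solves w(j)⁻¹ w(σ⁻¹ j) = r(j) u(j) for the cycle σ, starting from w(a) = 1; the equation at `a`
  -- closes up by the choice of `r a`.
  let w : α → U := fun j => if j = b then (u b)⁻¹ else if j = c then (u b)⁻¹ * (u c)⁻¹ else 1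
  refine ⟨w, fun j hb hc => by simp [w, hb, hc], ?_⟩
  rw [mem_twistedTop]
  have := G.mul_mem hr hg
  rw [eq_baseHom_left_mul_topHom g, hgσ, ← mul_assoc, ← map_mul] at this
  convert this using 1
  rw [mul_assoc, topHom_mul_baseHom, ← mul_assoc, ← map_inv, ← map_mul]
  congr 2
  ext j
  simp only [Pi.mul_apply, Pi.inv_apply]
  by_cases ha : j = a
  · subst ha
    rw [ia]
    simp [w, r, hab, hac, hbc.symm, ← hu]
  · by_cases hb : j = b
    · subst hb
      rw [ib]
      simp [w, r, hab, hab.symm, hac, ← hu]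
    · by_cases hc : j = c
      · subst hc
        rw [ic]
        simp [w, r, hac.symm, hbc.symm, ← hu]
      · have : (cyc3 a b c)⁻¹ j = j := Perm.inv_eq_iff_eq.2 (cyc3_apply_of_ne ha hb hc).symm
        rw [this]
        simp [w, r, ha, hb, hc, ← hu]

lemma exists_mem_alternatingGroup_apply_eq [Fintype α] (hα : 3 ≤ Fintype.card α) (i j : α) :
    ∃ τ ∈ alternatingGroup α, τ i = j := by
  by_cases hij : i = j
  · exact ⟨1, one_mem _, hij⟩
  · obtain ⟨e, he⟩ : ∃ e, e ∉ ({i, j} : Finset α) := by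
      by_contra! h
      have h1 := Finset.card_le_two (a := i) (b := j)
      rw [Finset.eq_univ_of_forall h, Finset.card_univ] at h1
      omega
    simp only [Finset.mem_insert, Finset.mem_singleton, not_or] at he
    exact ⟨cyc3 i j e, cyc3_mem_alternatingGroup hij (Ne.symm he.2),
      cyc3_apply_left hij (Ne.symm he.1)⟩

/-- One copy of `A` in coordinate `j₀` suffices: the conjugated alternating group is transitive and
spreads it to all coordinates. After conjugation by `v` these copies coincide, so they form a
standard wreath product. -/
theorem exists_injective_of_alternatingGroup_le_twistedTop {A : Type*} [Group A] [Fintype α]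
    (hα : 3 ≤ Fintype.card α) {v : α → U} (hv : alternatingGroup α ≤ twistedTop G v) {j₀ : α}
    {ψ : A →* U} (hψ : Function.Injective ψ) (hψG : ∀ x, ψ x ∈ coordSubgroup G j₀) :
    ∃ Θ : PermWreath A α (alternatingGroup α) →* PermWreath U α (⊤ : Subgroup (Perm α)),
      Function.Injective Θ ∧ ∀ x, Θ x ∈ G := by
  let ψ' : A →* U := (MulAut.conj (v j₀)).toMonoidHom.comp ψ
  have hψ' : Function.Injective ψ' := (MulAut.conj (v j₀)).injective.comp hψ
  let Φ : PermWreath A α (alternatingGroup α) →* PermWreath U α (⊤ : Subgroup (Perm α)) :=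
    SemidirectProduct.map (ψ'.compLeft α) (Subgroup.inclusion le_top) (fun σ => rfl)
  have hΦ : Function.Injective Φ := by
    intro x y hxy
    refine SemidirectProduct.ext ?_ ?_
    · ext j
      exact hψ' (congrFun (congrArg SemidirectProduct.left hxy) j)
    · exact Subgroup.inclusion_injective le_top (congrArg SemidirectProduct.right hxy)
  refine ⟨(MulAut.conj (baseHom v)⁻¹).toMonoidHom.comp Φ,
    (MulAut.conj (baseHom v)⁻¹).injective.comp hΦ, fun x => ?_⟩
  have hx : Φ x = baseHom (ψ'.compLeft α x.left) * topHom (x.right : Perm α) :=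
    eq_baseHom_left_mul_topHom _
  have h1 : (baseHom v)⁻¹ * topHom (x.right : Perm α) * baseHom v ∈ G :=
    mem_twistedTop.1 (hv x.right.2)
  have h2 : (baseHom v)⁻¹ * baseHom (ψ'.compLeft α x.left) * baseHom v ∈ G := by
    rw [← map_inv, ← map_mul, ← map_mul]
    refine baseHom_mem fun j => ?_
    obtain ⟨τ, hτ, rfl⟩ := exists_mem_alternatingGroup_apply_eq hα j₀ j
    have h3 := mem_twistedTop.1 (hv hτ)
    rw [mul_assoc, topHom_mul_baseHom, ← mul_assoc, ← map_inv, ← map_mul] at h3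
    have h5 := conj_mem_coordSubgroup h3 (hψG (x.left (τ j₀)))
    rw [permHom_baseHom_mul_topHom] at h5
    have h6 : (baseHom (v⁻¹ * fun j => v (τ⁻¹ j)) * topHom τ).left (τ j₀) =
        (v (τ j₀))⁻¹ * v j₀ := by
      rw [left_mul_apply]
      change (v (τ j₀))⁻¹ * v (τ⁻¹ (τ j₀)) * 1 = _
      simp
    rw [h6] at h5
    convert h5 using 1
    simp [ψ', mul_assoc]
  have := G.mul_mem h2 h1
  convert this using 1
  simp only [MonoidHom.comp_apply, hx]
  simp [mul_assoc]

end

end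

/-! ### Fullness and the induction over levels. -/

section

open Equiv

/-- A notion `F` of full subgroups of `U`: they contain a copy of `A`, and a subgroup is full as soon
as the orders of its nonabelian composition factors multiply to the order of `A`. -/
structure FullnessData (U A : Type) [Group U] [Group A] (F : Subgroup U → Prop) : Prop where
  finite_left : Finite U
  finite_right : Finite A
  mono : ∀ {K L : Subgroup U}, K ≤ L → F K → F L
  card_dvd : ∀ {K : Subgroup U}, F K → ∃ n, Nat.card U ∣ Nat.card K * 2 ^ n
  threeCore : ∀ {K : Subgroup U}, F K → F (threeCore K)
  embed : ∀ {K : Subgroup U}, F K → ∃ ψ : A →* U, Function.Injective ψ ∧ ∀ x, ψ x ∈ K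
  le_card : ∀ {K : Subgroup U} {m : ℕ}, SimpleChain False K m → m ≤ Nat.card A
  full : ∀ {K : Subgroup U}, SimpleChain False K (Nat.card A) → F K
  top_eq_one : ∀ {m : ℕ}, SimpleChain True (⊤ : Subgroup A) m → m = 1

lemma FullnessData.of_unique (U A : Type) [Group U] [Group A] [Unique U] [Unique A] :
    FullnessData U A (fun _ => True) where
  finite_left := inferInstance
  finite_right := inferInstance
  mono _ _ := trivial
  card_dvd _ := ⟨0, by simp⟩
  threeCore _ := trivial
  embed _ := ⟨1, Function.injective_of_subsingleton _, fun _ => Subgroup.one_mem _⟩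
  le_card h := h.le_card.trans (by simp)
  full _ := trivial
  top_eq_one h := le_antisymm (h.le_card.trans (by simp)) h.pos

lemma SimpleChain.wreath_split {U α : Type*} [Group U] [Finite U] [Finite α] {p : Prop}
    {K : Subgroup (PermWreath U α (⊤ : Subgroup (Perm α)))} {m : ℕ} (h : SimpleChain p K m) :
    ∃ a b, SimpleChain p (K.comap baseHom) a ∧ SimpleChain p (K.map permHom) b ∧ m = a * b := by
  obtain ⟨a, b, ha, hb, hm⟩ := h.semidirect_split
  refine ⟨a, b, ha, ?_, hm⟩
  rw [permHom, ← Subgroup.map_map]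
  exact hb.map_of_injective (Subgroup.subtype_injective _)

variable {U : Type} [Group U] {α : Type} [Fintype α] [DecidableEq α]

/-- `G` has large image in the symmetric group, and full intersection with every coordinate of the
base group. -/
def WreathFull (F : Subgroup U → Prop)
    (G : Subgroup (PermWreath U α (⊤ : Subgroup (Perm α)))) : Prop :=
  alternatingGroup α ≤ G.map permHom ∧ ∀ j, F (coordSubgroup G j)

lemma prod_card_coordSubgroup_mul_card_map_dvd [Finite U]
    (G : Subgroup (PermWreath U α (⊤ : Subgroup (Perm α)))) :
    (∏ j, Nat.card (coordSubgroup G j)) * Nat.card (G.map permHom) ∣ Nat.card G := by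
  have : Finite (PermWreath U α (⊤ : Subgroup (Perm α))) :=
    Finite.of_equiv _ SemidirectProduct.equivProd.symm
  rw [← Subgroup.card_inf_ker_mul_card_map G permHom]
  refine Nat.mul_dvd_mul_right ?_ _
  have h1 : Subgroup.pi Set.univ (coordSubgroup G) ≤ G.comap baseHom :=
    fun u hu => baseHom_mem fun j => hu j trivial
  have h2 : Nat.card (Subgroup.pi Set.univ (coordSubgroup G)) =
      ∏ j, Nat.card (coordSubgroup G j) := by
    rw [← Nat.card_pi]
    exact Nat.card_congr (Equiv.Set.univPi fun j => (coordSubgroup G j : Set U))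
  rw [← h2, ← Subgroup.card_map_of_injective (K := Subgroup.pi Set.univ (coordSubgroup G))
    baseHom_injective]
  refine Subgroup.card_dvd_of_le (le_inf (Subgroup.map_le_iff_le_comap.2 h1) ?_)
  rintro _ ⟨u, -, rfl⟩
  have := permHom_baseHom_mul_topHom u (1 : Perm α)
  rwa [map_one, mul_one] at this

lemma card_permWreath {A α : Type} [Group A] [Fintype α] (Γ : Subgroup (Perm α)) :
    Nat.card (PermWreath A α Γ) = Nat.card A ^ Fintype.card α * Nat.card Γ := by
  rw [SemidirectProduct.card, Nat.card_fun, Nat.card_eq_fintype_card (α := α)]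

lemma card_alternatingGroup_not_prime (hα : 5 ≤ Fintype.card α) :
    ¬ (Nat.card (alternatingGroup α)).Prime := by
  have : Nontrivial α := Fintype.one_lt_card_iff_nontrivial.1 (by omega)
  have h1 := two_mul_nat_card_alternatingGroup (α := α)
  rw [Nat.card_eq_fintype_card (α := Perm α), Fintype.card_perm] at h1
  have h2 : Nat.factorial 5 ∣ (Fintype.card α).factorial := Nat.factorial_dvd_factorial hα
  rw [← h1, show Nat.factorial 5 = 2 * 60 from rfl] at h2
  have h3 : 60 ∣ Nat.card (alternatingGroup α) := Nat.dvd_of_mul_dvd_mul_left (by norm_num) h2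
  intro hp
  have h4 := (Nat.prime_dvd_prime_iff_eq Nat.prime_two hp).1 (dvd_trans (by norm_num) h3)
  rw [← h4] at h3
  norm_num at h3

/-- The order condition loses one factor 2 for the top group besides those of the coordinates.
Fullness survives passage to the 3-core because 3-cycles lift to elements of 3-power order. -/
theorem FullnessData.wreath {A : Type} [Group A] {F : Subgroup U → Prop} (h : FullnessData U A F)
    (hα : 5 ≤ Fintype.card α) : FullnessData (PermWreath U α (⊤ : Subgroup (Perm α)))
      (PermWreath A α (alternatingGroup α)) (WreathFull F) := by
  have : Finite U := h.finite_left
  have : Finite A := h.finite_right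
  have : Nontrivial α := Fintype.one_lt_card_iff_nontrivial.1 (by omega)
  have : Finite (PermWreath U α (⊤ : Subgroup (Perm α))) :=
    Finite.of_equiv _ SemidirectProduct.equivProd.symm
  refine
  { finite_left := this
    finite_right := Finite.of_equiv _ SemidirectProduct.equivProd.symm
    mono := fun {K L} hKL hK => ⟨hK.1.trans (Subgroup.map_mono hKL), fun j =>
      h.mono (Subgroup.comap_mono hKL) (hK.2 j)⟩
    card_dvd := fun {K} hK => ?_
    threeCore := fun {K} hK => ⟨?_, fun j => h.mono (threeCore_le_comap le_rfl)
      (h.threeCore (hK.2 j))⟩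
    embed := fun {K} hK => ?_
    le_card := fun {K m} hm => ?_
    full := fun {K} hm => ?_
    top_eq_one := fun {m} hm => ?_ }
  · choose n hn using fun j => h.card_dvd (hK.2 j)
    refine ⟨∑ j, n j + 1, ?_⟩
    have h1 : Nat.card U ^ Fintype.card α ∣
        (∏ j, Nat.card (coordSubgroup K j)) * 2 ^ ∑ j, n j := by
      rw [← Finset.prod_pow_eq_pow_sum, ← Finset.prod_mul_distrib, ← Finset.card_univ,
        ← Finset.prod_const]
      exact Finset.prod_dvd_prod_of_dvd _ _ fun j _ => hn j
    have h2 : Nat.card (⊤ : Subgroup (Perm α)) ∣ Nat.card (K.map permHom) * 2 := by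
      rw [Subgroup.card_top, ← two_mul_nat_card_alternatingGroup, mul_comm]
      exact Nat.mul_dvd_mul_right (Subgroup.card_dvd_of_le hK.1) 2
    rw [card_permWreath]
    refine (Nat.mul_dvd_mul h1 h2).trans ?_
    rw [mul_mul_mul_comm, ← pow_succ]
    exact Nat.mul_dvd_mul_right (prod_card_coordSubgroup_mul_card_map_dvd K) _
  · refine alternatingGroup_le_of_cyc3 fun a b c hab hac hbc => ?_
    obtain ⟨g, hg, hgσ, k, hk⟩ := exists_three_power_lift (cyc3_pow_three hab hac hbc)
      (hK.1 (cyc3_mem_alternatingGroup hab hbc))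
    exact ⟨g, mem_threeCore hg hk, hgσ⟩
  · obtain ⟨v, hv⟩ := (hasThreeCycleLifts_of_card_dvd hK.1 fun j =>
      h.card_dvd (h.threeCore (hK.2 j))).exists_alternatingGroup_le hα
    obtain ⟨j₀⟩ : Nonempty α := inferInstance
    obtain ⟨ψ, hψ, hψK⟩ := h.embed (hK.2 j₀)
    exact exists_injective_of_alternatingGroup_le_twistedTop (by omega) hv hψ hψK
  · obtain ⟨a, b, ha, hb, rfl⟩ := hm.wreath_split
    rw [card_permWreath]
    exact Nat.mul_le_mul (SimpleChain.pi_le (fun _ _ => h.le_card) _ rfl _ _ ha) hb.perm_le.1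
  · obtain ⟨a, b, ha, hb, hab⟩ := hm.wreath_split
    rw [card_permWreath] at hab
    have h1 := SimpleChain.pi_le (fun _ _ => h.le_card) _ rfl _ _ ha
    have h2 := hb.perm_le
    have h3 := ha.pos
    have h4 := hb.pos
    obtain rfl : a = Nat.card A ^ Fintype.card α := by
      refine le_antisymm h1 ?_
      by_contra h5
      exact absurd hab (Nat.mul_lt_mul_of_lt_of_le (by omega) h2.1 (h4.trans_le h2.1)).ne'
    exact ⟨h2.2 (Nat.eq_of_mul_eq_mul_left h3 hab).symm, fun j =>
      h.full (ha.pi_eq (fun _ _ => h.le_card) j)⟩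
  · obtain ⟨a, b, ha, hb, rfl⟩ := hm.semidirect_split
    have : IsSimpleGroup (alternatingGroup α) :=
      alternatingGroup.isSimpleGroup (by simpa using hα)
    rw [Subgroup.map_top_of_surjective _ SemidirectProduct.rightHom_surjective] at hb
    rw [Subgroup.comap_top] at ha
    rw [SimpleChain.pi_top_eq_one (fun _ => h.top_eq_one) _ rfl _ ha,
      hb.eq_one_of_isSimpleGroup (card_alternatingGroup_not_prime hα)]

theorem exists_fullnessData : ∀ (r : ℕ) (d : Fin r → ℕ), (∀ i, 5 ≤ d i) →
    ∃ F, FullnessData (iterWreathSymm d) (iterWreathAlt d) F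
  | 0, _, _ => ⟨_, FullnessData.of_unique PUnit PUnit⟩
  | r + 1, d, hd => by
    obtain ⟨F, hF⟩ := exists_fullnessData r (fun i => d i.succ) fun i => hd i.succ
    exact ⟨_, hF.wreath (α := Fin (d 0)) (by simpa using hd 0)⟩

end

theorem proposition7p1 (r : ℕ) (d : Fin r → ℕ) (hd : ∀ i, 5 ≤ d i)
    (G : Subgroup (iterWreathSymm d)) (hG : ContainsCompFactors G (iterWreathAlt d)) :
    ∃ H : Subgroup G, Nonempty (H ≃* iterWreathAlt d) := by
  obtain ⟨F, hF⟩ := exists_fullnessData r d hd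
  have := hF.finite_left
  have := hF.finite_right
  obtain ⟨m, hm, hchain⟩ := hG.exists_simpleChain fun _ => hF.top_eq_one
  have h1 := hchain.map_of_injective G.subtype_injective
  rw [← MonoidHom.range_eq_map, Subgroup.range_subtype] at h1
  -- The upper bound for subgroups meets the lower bound from the composition factors, so `G` is
  -- full.
  obtain rfl := le_antisymm (hF.le_card h1) hm
  obtain ⟨ψ, hψ, hψG⟩ := hF.embed (hF.full h1)
  have h2 : Function.Injective (ψ.codRestrict G hψG) := fun x y hxy =>
    hψ (congrArg Subtype.val hxy)
  exact ⟨_, ⟨(MonoidHom.ofInjective h2).symm⟩⟩
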